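/- Let $k\ge 1$ and let $n=3\cdot 2^k$ or $n=2^k$. Equip $\mathbb{Z}_n=\mathbb{Z}/n\mathbb{Z}$ with the normalized counting measure $\mu_n$ (each point has mass $1/n$), write $\chi_j(x)=e^{2\pi i jx/n}$ for $0\le j\le n-1$, let $\psi_n(j)=\min(j,n-j)$ for $0\le j\le n-1$, and let $A_{\psi_n}$ be the linear operator on complex functions on $\mathbb{Z}_n$ given by \[ A_{\psi_n}\Big(\sum_{j=0}^{n-1}a_j\chi_j\Big)=\sum_{j=0}^{n-1}\psi_n(j)\,a_j\chi_j . \] Let $\|\cdot\|_2$ and $\langle\cdot,\cdot\rangle$ denote the norm and inner product of $L_2(\mathbb{Z}_n,\mu_n)$, and set $0\log 0=0$. Then for every function $f:\mathbb{Z}_n\to[0,\infty)$, \[ \int_{\mathbb{Z}_n} f^2\log f^2\,d\mu_n-\|f\|_2^2\log\|f\|_2^2\le 2\,\langle f,A_{\psi_n}f\rangle . \] Moreover, the constant $2$ is optimal: if $C\in\mathbb{R}$ is such that \[ \int_{\mathbb{Z}_n} f^2\log f^2\,d\mu_n-\|f\|_2^2\log\|f\|_2^2\le C\,\langle f,A_{\psi_n}f\rangle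 \] for every $f:\mathbb{Z}_n\to[0,\infty)$, then $C\ge 2$. -/

import Mathlib

open MeasureTheory
open scoped ENNReal

namespace CyclicLSI

/-- The normalized counting measure on `ℤ/n`. -/
noncomputable def mu (n : ℕ) : Measure (ZMod n) :=
  (n : ℝ≥0∞)⁻¹ • Measure.count

/-- The word length on `ℤ/n`: `ψ_n(k) = min (k, n - k)` for `0 ≤ k ≤ n - 1`. -/
noncomputable def psi (n : ℕ) (k : ZMod n) : ℝ :=
  min (k.val : ℝ) ((n : ℝ) - (k.val : ℝ))

/-- The character `χ_k(x) = exp (2 π i k x / n)` of `ℤ/n`. -/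
noncomputable def chi (n : ℕ) [NeZero n] (k x : ZMod n) : ℂ :=
  ZMod.stdAddChar (k * x)

theorem chi_eq_exp (n : ℕ) [NeZero n] (k x : ZMod n) :
    chi n k x = Complex.exp (2 * Real.pi * Complex.I * (k.val : ℂ) * (x.val : ℂ) / n) := by
  have hk : (((k.val : ℤ) * (x.val : ℤ) : ℤ) : ZMod n) = k * x := by
    rw [Int.cast_mul, Int.cast_natCast, Int.cast_natCast, ZMod.natCast_zmod_val,
      ZMod.natCast_zmod_val]
  rw [chi, ← hk, ZMod.stdAddChar_coe, Int.cast_mul, Int.cast_natCast, Int.cast_natCast, mul_assoc]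
  congr 1
  ring

/-- The Fourier coefficient `a_k` in the expansion `f = ∑ k, a_k χ_k`. -/
noncomputable def coeff (n : ℕ) [NeZero n] (f : ZMod n → ℂ) (k : ZMod n) : ℂ :=
  ∫ x, f x * (starRingEnd ℂ) (chi n k x) ∂(mu n)

/-- The Fourier multiplier `A_γ : ∑ k, a_k χ_k ↦ ∑ k, γ(k) a_k χ_k`. -/
noncomputable def multiplier (n : ℕ) [NeZero n] (γ : ZMod n → ℝ) (f : ZMod n → ℂ) : ZMod n → ℂ :=
  fun x => ∑ k : ZMod n, (γ k : ℂ) * coeff n f k * chi n k x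

/-- The inner product of `L_2(ℤ/n, μ_n)`. -/
noncomputable def innerL2 (n : ℕ) (f g : ZMod n → ℂ) : ℂ :=
  ∫ x, f x * (starRingEnd ℂ) (g x) ∂(mu n)

/-- The entropy `∫ f² log f² dμ_n - ‖f‖₂² log ‖f‖₂²`, where `0 log 0 = 0`. -/
noncomputable def entropy (n : ℕ) (f : ZMod n → ℝ) : ℝ :=
  (∫ x, f x ^ 2 * Real.log (f x ^ 2) ∂(mu n)) -
    (eLpNorm f 2 (mu n)).toReal ^ 2 * Real.log ((eLpNorm f 2 (mu n)).toReal ^ 2)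

theorem integral_mu (n : ℕ) [NeZero n] (f : ZMod n → ℂ) :
    ∫ x, f x ∂(mu n) = (n : ℂ)⁻¹ * ∑ x, f x := by
  rw [mu, integral_smul_measure, integral_fintype (hf := Integrable.of_finite)]
  simp [Measure.real]

theorem conj_chi (n : ℕ) [NeZero n] (k x : ZMod n) :
    (starRingEnd ℂ) (chi n k x) = ZMod.stdAddChar (-(k * x)) := by
  rw [chi, ← AddChar.map_neg_eq_conj]

theorem coeff_sum_chi (n : ℕ) [NeZero n] (a : ZMod n → ℂ) (k : ZMod n) :
    coeff n (fun x => ∑ j, a j * chi n j x) k = a k := by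
  have hn : (n : ℂ) ≠ 0 := Nat.cast_ne_zero.mpr (NeZero.ne n)
  have key : ∀ j : ZMod n, ∑ x, chi n j x * (starRingEnd ℂ) (chi n k x) =
      if j = k then (n : ℂ) else 0 := by
    intro j
    have h := AddChar.sum_mulShift (j - k) (ZMod.isPrimitive_stdAddChar n)
    simp only [sub_eq_zero, ZMod.card] at h
    rw [Nat.cast_ite, Nat.cast_zero] at h
    rw [← h]
    refine Finset.sum_congr rfl fun x _ => ?_
    rw [conj_chi, chi, ← AddChar.map_add_eq_mul]
    congr 1
    ring
  rw [coeff, integral_mu]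
  simp only [Finset.sum_mul]
  rw [Finset.sum_comm]
  simp only [mul_assoc, ← Finset.mul_sum, key]
  simp
  field_simp

/-- The multiplier acts on Fourier series in the defining way. -/
theorem multiplier_sum_chi (n : ℕ) [NeZero n] (γ : ZMod n → ℝ) (a : ZMod n → ℂ) :
    multiplier n γ (fun x => ∑ k, a k * chi n k x) =
      fun x => ∑ k, (γ k : ℂ) * a k * chi n k x := by
  funext x
  simp only [multiplier, coeff_sum_chi]

/-- The Dirichlet form `⟨f, A_γ f⟩` is a real number. -/
theorem innerL2_multiplier_self (n : ℕ) [NeZero n] (γ : ZMod n → ℝ) (f : ZMod n → ℂ) :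
    innerL2 n f (multiplier n γ f) = ((∑ k, γ k * ‖coeff n f k‖ ^ 2 : ℝ) : ℂ) := by
  have h : ∀ k, ((γ k * ‖coeff n f k‖ ^ 2 : ℝ) : ℂ) =
      (n : ℂ)⁻¹ * ∑ x, f x * ((γ k : ℂ) * (starRingEnd ℂ) (coeff n f k) *
        (starRingEnd ℂ) (chi n k x)) := by
    intro k
    have h1 : ((γ k * ‖coeff n f k‖ ^ 2 : ℝ) : ℂ) =
        (γ k : ℂ) * (starRingEnd ℂ) (coeff n f k) * coeff n f k := by
      push_cast
      rw [mul_assoc, ← Complex.conj_mul']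
    rw [h1]
    conv_lhs => rw [show coeff n f k = (n : ℂ)⁻¹ * ∑ x, f x * (starRingEnd ℂ) (chi n k x) from
      integral_mu n _]
    conv_rhs => rw [show coeff n f k = (n : ℂ)⁻¹ * ∑ x, f x * (starRingEnd ℂ) (chi n k x) from
      integral_mu n _]
    rw [← mul_assoc, mul_comm _ ((n : ℂ)⁻¹), mul_assoc, Finset.mul_sum]
    congr 1
    refine Finset.sum_congr rfl fun x _ => ?_
    ring
  rw [Complex.ofReal_sum, Finset.sum_congr rfl fun k _ => h k, ← Finset.mul_sum, Finset.sum_comm,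
    innerL2, integral_mu]
  congr 1
  refine Finset.sum_congr rfl fun x _ => ?_
  simp only [multiplier, map_sum, map_mul, Complex.conj_ofReal, Finset.mul_sum]

/-- The log-Sobolev inequality on `ℤ/n` for the weight `γ` with constant `C`:
`∫ f² log f² dμ_n - ‖f‖₂² log ‖f‖₂² ≤ C ⟨f, A_γ f⟩` for all nonnegative `f`. -/
def LSI (n : ℕ) [NeZero n] (γ : ZMod n → ℝ) (C : ℝ) : Prop :=
  ∀ f : ZMod n → ℝ, (∀ x, 0 ≤ f x) →
    entropy n f ≤
      C * (innerL2 n (fun x => (f x : ℂ)) (multiplier n γ (fun x => (f x : ℂ)))).re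

end CyclicLSI

namespace CyclicLSI

/-! ### Entropy and Fourier analysis as finite sums -/

/-! Let m be the mean of f, h = f - m, c = ‖f‖₂ and s = ‖h‖₂², so that c² = m² + s. The fourth
derivative of x² log x² is -4/x² < 0, so its cubic Taylor polynomial at c dominates it, and the
entropy is at most an expression in c, m, s and the third moment U of h. By Parseval the energy is
d² + s with d² = ∑ (ψ(k) - 1) |ĥ(k)|², so what is needed is U ≤ 3 s d (`sum_cube_le`); a sum of
nonnegative terms then closes the inequality (`entropy_bound_arith`).

The third moment is a sum over triples of nonzero frequencies with sum zero. Two of the three lie on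
the same open half circle, and for even n a frequency k ≠ 0 is a sum of two elements of the positive
half in at most ψ(k) - 1 ways. Cauchy–Schwarz turns this count into the weight in d²
(`trilinear_le`). The form of n enters only through its parity.

Optimality comes from perturbing the constant 1 along the lowest character, where ψ = 1. -/

theorem integral_mu_real (n : ℕ) [NeZero n] (f : ZMod n → ℝ) :
    ∫ x, f x ∂(mu n) = (n : ℝ)⁻¹ * ∑ x, f x := by
  rw [mu, integral_smul_measure, integral_fintype (hf := Integrable.of_finite)]
  simp [Measure.real]

theorem isFiniteMeasure_mu (n : ℕ) [NeZero n] : IsFiniteMeasure (mu n) := by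
  refine ⟨?_⟩
  rw [mu, Measure.smul_apply, smul_eq_mul]
  exact ENNReal.mul_lt_top (by simp [Nat.pos_of_neZero]) (measure_lt_top _ _)

theorem eLpNorm_two_sq (n : ℕ) [NeZero n] (f : ZMod n → ℝ) :
    (eLpNorm f 2 (mu n)).toReal ^ 2 = (n : ℝ)⁻¹ * ∑ x, f x ^ 2 := by
  have := isFiniteMeasure_mu n
  have hf : MemLp f 2 (mu n) := MemLp.of_discrete
  have h0 : 0 ≤ ∫ x, f x ^ 2 ∂(mu n) := integral_nonneg fun x => sq_nonneg _
  rw [hf.eLpNorm_eq_integral_rpow_norm (by norm_num) (by norm_num), ← integral_mu_real]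
  have h1 : ∫ x, ‖f x‖ ^ (2 : ℝ≥0∞).toReal ∂(mu n) = ∫ x, f x ^ 2 ∂(mu n) := by
    simp
  rw [h1, ENNReal.toReal_ofReal (by positivity), ENNReal.toReal_ofNat, ← Real.rpow_natCast,
    ← Real.rpow_mul h0]
  simp

theorem entropy_eq_sum (n : ℕ) [NeZero n] (f : ZMod n → ℝ) :
    entropy n f = (n : ℝ)⁻¹ * ∑ x, f x ^ 2 * Real.log (f x ^ 2) -
      ((n : ℝ)⁻¹ * ∑ x, f x ^ 2) * Real.log ((n : ℝ)⁻¹ * ∑ x, f x ^ 2) := by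
  rw [entropy, eLpNorm_two_sq, integral_mu_real]

theorem coeff_eq_sum (n : ℕ) [NeZero n] (f : ZMod n → ℂ) (k : ZMod n) :
    coeff n f k = (n : ℂ)⁻¹ * ∑ x, f x * (starRingEnd ℂ) (chi n k x) :=
  integral_mu n _

theorem sum_coeff_mul_chi (n : ℕ) [NeZero n] (f : ZMod n → ℂ) (x : ZMod n) :
    ∑ k, coeff n f k * chi n k x = f x := by
  have hn : (n : ℂ) ≠ 0 := Nat.cast_ne_zero.mpr (NeZero.ne n)
  have key : ∀ y : ZMod n, ∑ k, (starRingEnd ℂ) (chi n k y) * chi n k x =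
      if x = y then (n : ℂ) else 0 := by
    intro y
    have h := AddChar.sum_mulShift (x - y) (ZMod.isPrimitive_stdAddChar n)
    simp only [sub_eq_zero, ZMod.card] at h
    rw [Nat.cast_ite, Nat.cast_zero] at h
    rw [← h]
    refine Finset.sum_congr rfl fun k _ => ?_
    rw [conj_chi, chi, ← AddChar.map_add_eq_mul]
    congr 1
    ring
  simp only [coeff_eq_sum, Finset.mul_sum, Finset.sum_mul]
  rw [Finset.sum_comm]
  simp only [mul_assoc, ← Finset.mul_sum, key]
  simp
  field_simp

theorem coeff_neg_ofReal (n : ℕ) [NeZero n] (f : ZMod n → ℝ) (k : ZMod n) :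
    coeff n (fun x => (f x : ℂ)) (-k) = (starRingEnd ℂ) (coeff n (fun x => (f x : ℂ)) k) := by
  simp only [coeff_eq_sum, conj_chi, map_mul, map_sum, map_inv₀, map_natCast, Complex.conj_ofReal,
    ← AddChar.map_neg_eq_conj, neg_mul, neg_neg]

theorem parseval_ofReal (n : ℕ) [NeZero n] (f : ZMod n → ℝ) :
    ∑ k, ‖coeff n (fun x => (f x : ℂ)) k‖ ^ 2 = (n : ℝ)⁻¹ * ∑ x, f x ^ 2 := by
  have h := innerL2_multiplier_self n (fun _ => 1) (fun x => (f x : ℂ))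
  have h1 : multiplier n (fun _ => 1) (fun x => (f x : ℂ)) = fun x => (f x : ℂ) := by
    funext x
    simp [multiplier, sum_coeff_mul_chi]
  rw [h1, innerL2, integral_mu] at h
  simp only [one_mul, Complex.conj_ofReal] at h
  apply Complex.ofReal_injective
  rw [← h]
  push_cast
  simp only [sq]

theorem sum_cube_eq (n : ℕ) [NeZero n] (f : ZMod n → ℝ) :
    (((n : ℝ)⁻¹ * ∑ x, f x ^ 3 : ℝ) : ℂ) =
      ∑ i, ∑ j, coeff n (fun x => (f x : ℂ)) i * coeff n (fun x => (f x : ℂ)) j *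
        coeff n (fun x => (f x : ℂ)) (-(i + j)) := by
  set a := coeff n (fun x => (f x : ℂ)) with ha
  have h1 : ∀ x, (f x : ℂ) ^ 3 =
      ∑ i, ∑ j, a i * a j * ((f x : ℂ) * (starRingEnd ℂ) (chi n (-(i + j)) x)) := by
    intro x
    have hx : (f x : ℂ) = ∑ k, a k * chi n k x := (sum_coeff_mul_chi n (fun x => (f x : ℂ)) x).symm
    have h2 : (f x : ℂ) ^ 3 = (∑ i, a i * chi n i x) * (∑ j, a j * chi n j x) * f x := by
      rw [← hx]; ring
    rw [h2, Finset.sum_mul_sum, Finset.sum_mul]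
    refine Finset.sum_congr rfl fun i _ => ?_
    rw [Finset.sum_mul]
    refine Finset.sum_congr rfl fun j _ => ?_
    have h3 : (starRingEnd ℂ) (chi n (-(i + j)) x) = chi n i x * chi n j x := by
      rw [conj_chi, chi, chi, ← AddChar.map_add_eq_mul]
      congr 1
      ring
    rw [h3]
    ring
  push_cast
  simp only [h1]
  rw [Finset.sum_comm, Finset.mul_sum]
  refine Finset.sum_congr rfl fun i _ => ?_
  rw [Finset.sum_comm, Finset.mul_sum]
  refine Finset.sum_congr rfl fun j _ => ?_
  rw [← Finset.mul_sum, ha, coeff_eq_sum n _ (-(i + j))]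
  ring

/-! ### The trilinear estimate -/

/-- The residues strictly between `0` and `n / 2`. -/
def posPart (n : ℕ) [NeZero n] : Finset (ZMod n) :=
  Finset.univ.filter fun i => 0 < i.val ∧ 2 * i.val < n

theorem mem_posPart {n : ℕ} [NeZero n] {i : ZMod n} :
    i ∈ posPart n ↔ 0 < i.val ∧ 2 * i.val < n := by
  simp [posPart]

theorem neg_mem_posPart {n : ℕ} [NeZero n] {i : ZMod n} :
    -i ∈ posPart n ↔ n < 2 * i.val := by
  have h := ZMod.val_lt i
  rw [mem_posPart, ZMod.neg_val]
  split_ifs with h0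
  · subst h0
    simp
  · have : i.val ≠ 0 := by rwa [Ne, ZMod.val_eq_zero]
    omega

/-- Among three nonzero residues with sum zero, two lie on the same open half circle. -/
theorem exists_pair_mem_posPart {n : ℕ} [NeZero n] (hn : Even n) {i j : ZMod n} (hi : i ≠ 0)
    (hj : j ≠ 0) (hij : i + j ≠ 0) :
    ((i ∈ posPart n ∧ j ∈ posPart n) ∨ (-i ∈ posPart n ∧ -j ∈ posPart n)) ∨
    ((-(i + j) ∈ posPart n ∧ j ∈ posPart n) ∨ (i + j ∈ posPart n ∧ -j ∈ posPart n)) ∨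
    ((i ∈ posPart n ∧ -(i + j) ∈ posPart n) ∨ (-i ∈ posPart n ∧ i + j ∈ posPart n)) := by
  obtain ⟨m, rfl⟩ := hn
  simp only [neg_mem_posPart]
  simp only [mem_posPart]
  have h1 := ZMod.val_lt i
  have h2 := ZMod.val_lt j
  rw [Ne, ← ZMod.val_eq_zero] at hi hj hij
  have h3 : (i + j).val = i.val + j.val ∨ (i + j).val + (m + m) = i.val + j.val := by
    rcases lt_or_ge (i.val + j.val) (m + m) with h | h
    · exact Or.inl (ZMod.val_add_of_lt h)
    · exact Or.inr (ZMod.val_add_val_of_le h).symm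
  have h4 := ZMod.val_lt (i + j)
  -- If one residue is n/2, the other two are not n/2 (else the third vanishes) and sum to n/2 mod
  -- n, so they share a half. Otherwise the pigeonhole principle applies.
  omega

/-- Two elements of the positive half add without wrapping around, so i ranges over an interval of
integers. Evenness gains the -1 for k beyond n/2: the half stops at n/2 - 1, which leaves at most n
- k - 1 values. -/
theorem card_posPart_pairs_le {n : ℕ} [NeZero n] (hn : Even n) {k : ZMod n} (hk : k ≠ 0) :
    (((posPart n).filter fun i => k - i ∈ posPart n).card : ℝ) ≤ psi n k - 1 := by
  have h0 : 0 < k.val := Nat.pos_of_ne_zero (by rwa [Ne, ZMod.val_eq_zero])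
  obtain ⟨l, hl⟩ := hn
  have hlt := ZMod.val_lt k
  have key : ∀ i ∈ (posPart n).filter fun i => k - i ∈ posPart n,
      0 < i.val ∧ i.val < k.val ∧ 2 * i.val < n ∧ 2 * (k.val - i.val) < n := by
    intro i hi
    rw [Finset.mem_filter, mem_posPart, mem_posPart] at hi
    have h := ZMod.val_add_of_lt (a := k - i) (b := i) (by omega)
    rw [sub_add_cancel] at h
    omega
  have hinj : Set.InjOn ZMod.val (((posPart n).filter fun i => k - i ∈ posPart n : Finset _) :
      Set (ZMod n)) := (ZMod.val_injective n).injOn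
  have c1 : ((posPart n).filter fun i => k - i ∈ posPart n).card + 1 ≤ k.val := by
    have := Finset.card_le_card_of_injOn (t := Finset.Ioo 0 k.val) ZMod.val
      (fun i hi => by have := key i hi; rw [Finset.coe_Ioo, Set.mem_Ioo]; omega) hinj
    rw [Nat.card_Ioo] at this
    omega
  have c2 : ((posPart n).filter fun i => k - i ∈ posPart n).card + 1 + k.val ≤ n := by
    by_cases hs : ((posPart n).filter fun i => k - i ∈ posPart n) = ∅
    · rw [hs]; simp; omega
    obtain ⟨i₀, hi₀⟩ := Finset.nonempty_iff_ne_empty.mpr hs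
    have := key i₀ hi₀
    have := Finset.card_le_card_of_injOn (t := Finset.Icc (k.val - (n - 1) / 2) ((n - 1) / 2))
      ZMod.val (fun i hi => by have := key i hi; rw [Finset.coe_Icc, Set.mem_Icc]; omega) hinj
    rw [Nat.card_Icc] at this
    omega
  rw [psi, le_sub_iff_add_le, le_min_iff, le_sub_iff_add_le]
  exact ⟨by exact_mod_cast c1, by exact_mod_cast c2⟩

/-- Cauchy–Schwarz over pairs, separating b i * b j from b (i + j); the second factor counts each k
with its number of representations. -/
theorem sum_posPart_trilinear_le {n : ℕ} [NeZero n] (hn : Even n) {b : ZMod n → ℝ} (h0 : b 0 = 0) :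
    ∑ i ∈ posPart n, ∑ j ∈ posPart n, b i * b j * b (i + j) ≤
      (∑ i ∈ posPart n, b i ^ 2) * √(∑ k, (psi n k - 1) * b k ^ 2) := by
  have hcount : ∑ p ∈ posPart n ×ˢ posPart n, b (p.1 + p.2) ^ 2 ≤
      ∑ k, (psi n k - 1) * b k ^ 2 := by
    calc ∑ p ∈ posPart n ×ˢ posPart n, b (p.1 + p.2) ^ 2
        = ∑ i ∈ posPart n, ∑ k, if k - i ∈ posPart n then b k ^ 2 else 0 := by
          rw [Finset.sum_product]
          refine Finset.sum_congr rfl fun i _ => ?_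
          rw [← Equiv.sum_comp (Equiv.addLeft i), ← Finset.sum_filter]
          simp
      _ = ∑ k, (((posPart n).filter fun i => k - i ∈ posPart n).card : ℝ) * b k ^ 2 := by
          rw [Finset.sum_comm]
          refine Finset.sum_congr rfl fun k _ => ?_
          rw [← Finset.sum_filter, Finset.sum_const, nsmul_eq_mul]
      _ ≤ ∑ k, (psi n k - 1) * b k ^ 2 := by
          refine Finset.sum_le_sum fun k _ => ?_
          by_cases hk : k = 0
          · simp [hk, h0]
          · exact mul_le_mul_of_nonneg_right (card_posPart_pairs_le hn hk) (sq_nonneg _)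
  have hcs := Real.sum_mul_le_sqrt_mul_sqrt (posPart n ×ˢ posPart n)
    (fun p => b p.1 * b p.2) (fun p => b (p.1 + p.2))
  have hsq : ∑ p ∈ posPart n ×ˢ posPart n, (b p.1 * b p.2) ^ 2 =
      (∑ i ∈ posPart n, b i ^ 2) ^ 2 := by
    rw [sq (∑ i ∈ posPart n, b i ^ 2), Finset.sum_mul_sum, Finset.sum_product]
    simp only [mul_pow]
  rw [hsq, Real.sqrt_sq (Finset.sum_nonneg fun _ _ => sq_nonneg _), Finset.sum_product] at hcs
  refine hcs.trans ?_
  gcongr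

/-- Each nonzero term is charged to a pair of its zero-sum triple lying in one half: three pairs and
two halves give six copies of the sum over the positive half. That half carries at most half of ∑
b², so 6 becomes 3. -/
theorem trilinear_le {n : ℕ} [NeZero n] (hn : Even n) {b : ZMod n → ℝ} (hb : ∀ k, 0 ≤ b k)
    (hneg : ∀ k, b (-k) = b k) (h0 : b 0 = 0) :
    ∑ i, ∑ j, b i * b j * b (i + j) ≤
      3 * (∑ k, b k ^ 2) * √(∑ k, (psi n k - 1) * b k ^ 2) := by
  classical
  set g : ZMod n → ZMod n → ℝ := fun i j => if i ∈ posPart n ∧ j ∈ posPart n then 1 else 0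
  set G : ZMod n → ZMod n → ℝ := fun i j => g i j + g (-i) (-j)
  set t : ZMod n → ZMod n → ℝ := fun i j => b i * b j * b (i + j)
  have ht : ∀ i j, 0 ≤ t i j := fun i j => mul_nonneg (mul_nonneg (hb i) (hb j)) (hb _)
  have hg : ∀ i j, 0 ≤ g i j := fun i j => by simp only [g]; split_ifs <;> norm_num
  have hg1 : ∀ i j, i ∈ posPart n ∧ j ∈ posPart n → g i j = 1 := fun i j h => if_pos h
  have hcover : ∀ i j, t i j ≤
      G i j * t i j + G (-(i + j)) j * t i j + G i (-(i + j)) * t i j := by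
    intro i j
    by_cases hz : i = 0 ∨ j = 0 ∨ i + j = 0
    · have : t i j = 0 := by
        rcases hz with h | h | h <;> simp [t, h, h0]
      simp [this]
    push Not at hz
    have key : 1 ≤ G i j + G (-(i + j)) j + G i (-(i + j)) := by
      have e1 := hg i j
      have e2 := hg (-i) (-j)
      have e3 := hg (-(i + j)) j
      have e4 := hg (i + j) (-j)
      have e5 := hg i (-(i + j))
      have e6 := hg (-i) (i + j)
      simp only [G, neg_neg]
      rcases exists_pair_mem_posPart hn hz.1 hz.2.1 hz.2.2 with (h | h) | (h | h) | (h | h) <;>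
        linarith [hg1 _ _ h]
    nlinarith [ht i j]
  have hsum : ∑ i, ∑ j, G i j * t i j = 2 * ∑ i ∈ posPart n, ∑ j ∈ posPart n, t i j := by
    have e1 : ∑ i, ∑ j, g i j * t i j = ∑ i ∈ posPart n, ∑ j ∈ posPart n, t i j := by
      have : ∀ i j, g i j * t i j =
          if i ∈ posPart n then (if j ∈ posPart n then t i j else 0) else 0 := by
        intro i j
        simp only [g]
        split_ifs <;> simp_all
      simp [this]
    have e2 : ∑ i, ∑ j, g (-i) (-j) * t i j = ∑ i, ∑ j, g i j * t i j := by
      rw [← Equiv.sum_comp (Equiv.neg (ZMod n)) fun i => ∑ j, g i j * t i j]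
      refine Finset.sum_congr rfl fun i _ => ?_
      rw [← Equiv.sum_comp (Equiv.neg (ZMod n)) fun j => g (Equiv.neg (ZMod n) i) j * _]
      refine Finset.sum_congr rfl fun j _ => ?_
      simp only [Equiv.neg_apply, t, hneg, ← neg_add]
    simp only [G, add_mul, Finset.sum_add_distrib]
    rw [e2, e1]
    ring
  -- As b is even, t is symmetric in the triple (i, j, -(i + j)), so exchanging j with -(i + j)
  -- preserves it.
  have hright : ∑ i, ∑ j, G i (-(i + j)) * t i j = ∑ i, ∑ j, G i j * t i j := by
    refine Finset.sum_congr rfl fun i _ => ?_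
    rw [← Equiv.sum_comp (Equiv.subLeft (-i)) fun j => G i j * t i j]
    refine Finset.sum_congr rfl fun j _ => ?_
    have e1 : -i - j = -(i + j) := by ring
    have e2 : i + -(i + j) = -j := by ring
    simp only [Equiv.subLeft_apply, t, e1, e2, hneg]
    ring
  have hleft : ∑ i, ∑ j, G (-(i + j)) j * t i j = ∑ i, ∑ j, G i j * t i j := by
    rw [Finset.sum_comm, Finset.sum_comm (f := fun i j => G i j * t i j)]
    refine Finset.sum_congr rfl fun j _ => ?_
    rw [← Equiv.sum_comp (Equiv.subLeft (-j)) fun i => G i j * t i j]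
    refine Finset.sum_congr rfl fun i _ => ?_
    have e1 : -j - i = -(i + j) := by ring
    have e2 : -(i + j) + j = -i := by ring
    simp only [Equiv.subLeft_apply, t, e1, e2, hneg]
    ring
  have hhalf : 2 * ∑ i ∈ posPart n, b i ^ 2 ≤ ∑ k, b k ^ 2 := by
    have e1 : ∑ i ∈ posPart n, b i ^ 2 = ∑ i, if i ∈ posPart n then b i ^ 2 else 0 := by simp
    have e2 : ∑ i ∈ posPart n, b i ^ 2 = ∑ i, if -i ∈ posPart n then b i ^ 2 else 0 := by
      rw [e1, ← Equiv.sum_comp (Equiv.neg (ZMod n))]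
      simp [hneg]
    rw [two_mul]
    nth_rewrite 1 [e1]
    rw [e2, ← Finset.sum_add_distrib]
    refine Finset.sum_le_sum fun i _ => ?_
    have hdisj : i ∈ posPart n → -i ∉ posPart n := by
      rw [neg_mem_posPart, mem_posPart]
      omega
    split_ifs with h1 h2
    · exact absurd h2 (hdisj h1)
    all_goals nlinarith [sq_nonneg (b i)]
  have hR := sum_posPart_trilinear_le hn h0
  have hD := Real.sqrt_nonneg (∑ k, (psi n k - 1) * b k ^ 2)
  calc ∑ i, ∑ j, t i j
      ≤ ∑ i, ∑ j, (G i j * t i j + G (-(i + j)) j * t i j + G i (-(i + j)) * t i j) :=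
        Finset.sum_le_sum fun i _ => Finset.sum_le_sum fun j _ => hcover i j
    _ = 6 * ∑ i ∈ posPart n, ∑ j ∈ posPart n, t i j := by
        simp only [Finset.sum_add_distrib]
        rw [hleft, hright, hsum]
        ring
    _ ≤ _ := by nlinarith

/-- The cubic Taylor polynomial of `x² log x²` at `c` is an upper bound on `[0, ∞)`. -/
theorem sq_mul_log_sq_le {x c : ℝ} (hx : 0 ≤ x) (hc : 0 < c) :
    x ^ 2 * Real.log (x ^ 2) ≤
      2 / 3 * x ^ 3 / c + x ^ 2 - 2 * c * x + c ^ 2 / 3 + x ^ 2 * Real.log (c ^ 2) := by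
  rcases hx.eq_or_lt with rfl | hx
  · simp only [ne_eq, OfNat.ofNat_ne_zero, not_false_eq_true, zero_pow, zero_mul, mul_zero]
    simp
    positivity
  -- With y = x / c, this is the gap between the two sides divided by x². Its derivative changes
  -- sign only at y = 1, where φ vanishes.
  set φ : ℝ → ℝ := fun y => 2 / 3 * y + 1 - 2 / y + 1 / (3 * y ^ 2) - 2 * Real.log y
  have hder : ∀ y : ℝ, 0 < y → HasDerivAt φ (2 / 3 * (y - 1) ^ 3 / y ^ 3) y := by
    intro y hy
    have h1 := (((hasDerivAt_id y).const_mul (2 / 3 : ℝ)).add_const 1).sub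
      ((hasDerivAt_inv hy.ne').const_mul 2)
    have h2 := (((hasDerivAt_pow 2 y).const_mul 3).inv (by positivity : (3 * y ^ 2 : ℝ) ≠ 0))
    have h3 := (h1.add h2).sub ((Real.hasDerivAt_log hy.ne').const_mul 2)
    have e1 : φ = ((fun x => 2 / 3 * id x + 1) - fun y => 2 * y⁻¹) + (fun y => 3 * y ^ 2)⁻¹ -
        fun y => 2 * Real.log y := by
      funext z
      simp [φ, div_eq_mul_inv]
    have e2 : 2 / 3 * (y - 1) ^ 3 / y ^ 3 = 2 / 3 * 1 - 2 * -(y ^ 2)⁻¹ +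
        -(3 * (((2 : ℕ) : ℝ) * y ^ (2 - 1))) / (3 * y ^ 2) ^ 2 - 2 * y⁻¹ := by
      field_simp
      push_cast
      ring
    rw [e1, e2]
    exact h3
  have hφ : ∀ y : ℝ, 0 < y → 0 ≤ φ y := by
    intro y hy
    have hφ1 : φ 1 = 0 := by norm_num [φ]
    rw [← hφ1]
    rcases le_total y 1 with h | h
    · have hanti : AntitoneOn φ (Set.Icc y 1) := by
        refine antitoneOn_of_deriv_nonpos (convex_Icc _ _)
          (fun z hz => (hder z (hy.trans_le hz.1)).continuousAt.continuousWithinAt)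
          (fun z hz => ?_) (fun z hz => ?_) <;> rw [interior_Icc] at hz
        · exact (hder z (hy.trans hz.1)).differentiableAt.differentiableWithinAt
        · have hz0 := hy.trans hz.1
          rw [(hder z hz0).deriv]
          refine div_nonpos_of_nonpos_of_nonneg ?_ (by positivity)
          have : 0 ≤ (1 - z) ^ 3 := pow_nonneg (by linarith [hz.2]) 3
          nlinarith
      exact hanti ⟨le_rfl, h⟩ ⟨h, le_rfl⟩ h
    · have hmono : MonotoneOn φ (Set.Icc 1 y) := by
        refine monotoneOn_of_deriv_nonneg (convex_Icc _ _)
          (fun z hz => (hder z (one_pos.trans_le hz.1)).continuousAt.continuousWithinAt)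
          (fun z hz => ?_) (fun z hz => ?_) <;> rw [interior_Icc] at hz
        · exact (hder z (one_pos.trans hz.1)).differentiableAt.differentiableWithinAt
        · have hz0 : (0 : ℝ) < z := one_pos.trans hz.1
          have hz1 : (0 : ℝ) ≤ z - 1 := by linarith [hz.1]
          rw [(hder z hz0).deriv]
          positivity
      exact hmono ⟨le_rfl, h⟩ ⟨h, le_rfl⟩ h
  have h := mul_nonneg (sq_nonneg x) (hφ (x / c) (by positivity))
  have e : x ^ 2 * φ (x / c) = 2 / 3 * x ^ 3 / c + x ^ 2 - 2 * c * x + c ^ 2 / 3 +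
      x ^ 2 * Real.log (c ^ 2) - x ^ 2 * Real.log (x ^ 2) := by
    simp only [φ]
    rw [Real.log_div hx.ne' hc.ne', Real.log_pow, Real.log_pow]
    field_simp
    push_cast
    ring
  linarith

/-! ### Third moment, energy and the entropy bound -/

theorem psi_nonneg (n : ℕ) [NeZero n] (k : ZMod n) : 0 ≤ psi n k := by
  have : (k.val : ℝ) ≤ n := by exact_mod_cast (ZMod.val_lt k).le
  exact le_min (Nat.cast_nonneg _) (by linarith)

theorem one_le_psi {n : ℕ} [NeZero n] {k : ZMod n} (hk : k ≠ 0) : 1 ≤ psi n k := by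
  have h0 : 1 ≤ k.val := Nat.pos_of_ne_zero (by rwa [Ne, ZMod.val_eq_zero])
  have h1 : k.val + 1 ≤ n := ZMod.val_lt k
  refine le_min (by exact_mod_cast h0) ?_
  have : (k.val : ℝ) + 1 ≤ n := by exact_mod_cast h1
  linarith

theorem coeff_zero_ofReal (n : ℕ) [NeZero n] (f : ZMod n → ℝ) :
    coeff n (fun x => (f x : ℂ)) 0 = (((n : ℝ)⁻¹ * ∑ x, f x : ℝ) : ℂ) := by
  simp [coeff_eq_sum, chi]

theorem coeff_sub_const (n : ℕ) [NeZero n] (f : ZMod n → ℂ) (m : ℂ) {k : ZMod n} (hk : k ≠ 0) :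
    coeff n (fun x => f x - m) k = coeff n f k := by
  have h := AddChar.sum_mulShift (-k) (ZMod.isPrimitive_stdAddChar n)
  rw [if_neg (neg_ne_zero.mpr hk), Nat.cast_zero] at h
  have h' : ∑ x, (starRingEnd ℂ) (chi n k x) = 0 := by
    rw [← h]
    refine Finset.sum_congr rfl fun x _ => ?_
    rw [conj_chi]
    congr 1
    ring
  simp only [coeff_eq_sum, sub_mul, Finset.sum_sub_distrib, ← Finset.mul_sum, h']
  simp

/-- The third moment of a function of mean zero is controlled by its variance and energy. -/
theorem sum_cube_le {n : ℕ} [NeZero n] (hn : Even n) (h : ZMod n → ℝ) (hmean : ∑ x, h x = 0) :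
    (n : ℝ)⁻¹ * ∑ x, h x ^ 3 ≤ 3 * ((n : ℝ)⁻¹ * ∑ x, h x ^ 2) *
      √(∑ k, (psi n k - 1) * ‖coeff n (fun x => (h x : ℂ)) k‖ ^ 2) := by
  set a := coeff n (fun x => (h x : ℂ)) with ha
  have hneg : ∀ k, ‖a (-k)‖ = ‖a k‖ := fun k => by rw [ha, coeff_neg_ofReal, RCLike.norm_conj]
  have h0 : ‖a 0‖ = 0 := by rw [ha, coeff_zero_ofReal, hmean]; simp
  rw [← parseval_ofReal]
  refine le_trans ?_ (trilinear_le hn (b := fun k => ‖a k‖) (fun k => norm_nonneg _) hneg h0)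
  calc (n : ℝ)⁻¹ * ∑ x, h x ^ 3 ≤ ‖(((n : ℝ)⁻¹ * ∑ x, h x ^ 3 : ℝ) : ℂ)‖ := by
        rw [Complex.norm_real]; exact le_abs_self _
    _ ≤ ∑ i, ∑ j, ‖a i‖ * ‖a j‖ * ‖a (i + j)‖ := by
        rw [sum_cube_eq]
        refine (norm_sum_le _ _).trans (Finset.sum_le_sum fun i _ => ?_)
        refine (norm_sum_le _ _).trans (Finset.sum_le_sum fun j _ => ?_)
        rw [norm_mul, norm_mul, ← ha, hneg]

/-- After multiplication by c², the deficit is a square, plus (c - m)³(c + 3m)/6, plus a multiple of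
the slack in `hU`. -/
theorem entropy_bound_arith {c m s d U : ℝ} (hc : 0 < c) (hm : 0 ≤ m) (hs : 0 ≤ s)
    (hcm : c ^ 2 = m ^ 2 + s) (hU : U ≤ 3 * s * d) :
    2 / 3 * (m ^ 3 + 3 * m * s + U) / c + 4 / 3 * c ^ 2 - 2 * c * m ≤ 2 * (d ^ 2 + s) := by
  have hmc : m ≤ c := by nlinarith
  have h1 : 0 ≤ (c - m) ^ 3 * (c + 3 * m) := mul_nonneg (pow_nonneg (by linarith) 3) (by linarith)
  have hs' : s = c ^ 2 - m ^ 2 := by linarith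
  have h3 := mul_le_mul_of_nonneg_left hU hc.le
  have h2 : 0 ≤ (2 * c * d - s) ^ 2 := sq_nonneg _
  have e : 2 * (d ^ 2 + s) - (2 / 3 * (m ^ 3 + 3 * m * s + U) / c + 4 / 3 * c ^ 2 - 2 * c * m) =
      ((2 * c * d - s) ^ 2 / 2 + (c - m) ^ 3 * (c + 3 * m) / 6 +
        2 / 3 * (c * (3 * s * d) - c * U)) / c ^ 2 := by
    rw [hs']
    field_simp
    ring
  have : 0 ≤ ((2 * c * d - s) ^ 2 / 2 + (c - m) ^ 3 * (c + 3 * m) / 6 +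
        2 / 3 * (c * (3 * s * d) - c * U)) / c ^ 2 := by
    apply div_nonneg _ (by positivity)
    linarith
  linarith

theorem innerL2_psi_re (n : ℕ) [NeZero n] (f : ZMod n → ℂ) :
    (innerL2 n f (multiplier n (psi n) f)).re = ∑ k, psi n k * ‖coeff n f k‖ ^ 2 := by
  rw [innerL2_multiplier_self, Complex.ofReal_re]

/-- The log-Sobolev inequality with constant `2` on a cyclic group of even order. -/
theorem lsi_two_of_even {n : ℕ} [NeZero n] (hn : Even n) : LSI n (psi n) 2 := by
  intro f hf
  rw [innerL2_psi_re, entropy_eq_sum]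
  have hn0 : (n : ℝ) ≠ 0 := Nat.cast_ne_zero.mpr (NeZero.ne n)
  have hn1 : (0 : ℝ) < (n : ℝ)⁻¹ := by positivity
  set N := (n : ℝ)⁻¹ * ∑ x, f x ^ 2 with hN
  have hN0 : 0 ≤ N := mul_nonneg hn1.le (Finset.sum_nonneg fun _ _ => sq_nonneg _)
  rcases hN0.eq_or_lt with hz | hpos
  · have hfz : ∀ x, f x = 0 := by
      have h1 : ∑ x, f x ^ 2 = 0 := by
        rcases mul_eq_zero.mp (hN.symm.trans hz.symm) with h | h
        · exact absurd h hn1.ne'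
        · exact h
      intro x
      exact pow_eq_zero_iff two_ne_zero |>.mp
        ((Finset.sum_eq_zero_iff_of_nonneg fun _ _ => sq_nonneg _).mp h1 x (Finset.mem_univ x))
    rw [← hz]
    simp only [hfz]
    simp only [ne_eq, OfNat.ofNat_ne_zero, not_false_eq_true, zero_pow, zero_mul,
      Finset.sum_const_zero, mul_zero, sub_zero]
    exact mul_nonneg zero_le_two
      (Finset.sum_nonneg fun k _ => mul_nonneg (psi_nonneg n k) (sq_nonneg _))
  -- Expanding at the L² norm makes the log c² term integrate to exactly N log N.
  set c := √N
  have hc : 0 < c := Real.sqrt_pos.mpr hpos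
  have hc2 : c ^ 2 = N := Real.sq_sqrt hN0
  set m := (n : ℝ)⁻¹ * ∑ x, f x with hm
  have hm0 : 0 ≤ m := mul_nonneg hn1.le (Finset.sum_nonneg fun x _ => hf x)
  have hsumf : ∑ x, f x = n * m := by rw [hm]; field_simp
  have hsumf2 : ∑ x, f x ^ 2 = n * N := by rw [hN]; field_simp
  set h : ZMod n → ℝ := fun x => f x - m with hh
  have hmean : ∑ x, h x = 0 := by
    simp [hh, Finset.sum_sub_distrib, hsumf]
  set s := (n : ℝ)⁻¹ * ∑ x, h x ^ 2 with hs
  set U := (n : ℝ)⁻¹ * ∑ x, h x ^ 3 with hUdef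
  have hsN : c ^ 2 = m ^ 2 + s := by
    have : ∀ x, h x ^ 2 = f x ^ 2 - 2 * m * f x + m ^ 2 := fun x => by simp only [hh]; ring
    rw [hs, hc2]
    simp only [this, Finset.sum_add_distrib, Finset.sum_sub_distrib, ← Finset.mul_sum, hsumf,
      hsumf2, Finset.sum_const, Finset.card_univ, ZMod.card, nsmul_eq_mul]
    field_simp
    ring
  have hs0 : 0 ≤ s := mul_nonneg hn1.le (Finset.sum_nonneg fun _ _ => sq_nonneg _)
  have hcube : (n : ℝ)⁻¹ * ∑ x, f x ^ 3 = m ^ 3 + 3 * m * s + U := by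
    have : ∀ x, f x ^ 3 = m ^ 3 + 3 * m ^ 2 * h x + 3 * m * h x ^ 2 + h x ^ 3 :=
      fun x => by simp only [hh]; ring
    simp only [this, Finset.sum_add_distrib, ← Finset.mul_sum, hmean, Finset.sum_const,
      Finset.card_univ, ZMod.card, nsmul_eq_mul, hs, hUdef]
    field_simp
    ring
  set D := ∑ k, (psi n k - 1) * ‖coeff n (fun x => (h x : ℂ)) k‖ ^ 2 with hD
  have hcoeff0 : coeff n (fun x => (h x : ℂ)) 0 = 0 := by rw [coeff_zero_ofReal, hmean]; simp
  have hD0 : 0 ≤ D := by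
    refine Finset.sum_nonneg fun k _ => ?_
    by_cases hk : k = 0
    · rw [hk, hcoeff0]; simp
    · exact mul_nonneg (by linarith [one_le_psi hk]) (sq_nonneg _)
  have henergy : ∑ k, psi n k * ‖coeff n (fun x => (f x : ℂ)) k‖ ^ 2 = √D ^ 2 + s := by
    rw [Real.sq_sqrt hD0, hs, ← parseval_ofReal, hD, ← Finset.sum_add_distrib]
    refine Finset.sum_congr rfl fun k _ => ?_
    by_cases hk : k = 0
    · rw [hk, hcoeff0]; simp [psi]
    · have : coeff n (fun x => (h x : ℂ)) k = coeff n (fun x => (f x : ℂ)) k := by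
        simp only [hh, Complex.ofReal_sub]
        exact coeff_sub_const n _ _ hk
      rw [this]
      ring
  have hent : (n : ℝ)⁻¹ * ∑ x, f x ^ 2 * Real.log (f x ^ 2) - N * Real.log N ≤
      2 / 3 * (m ^ 3 + 3 * m * s + U) / c + 4 / 3 * c ^ 2 - 2 * c * m := by
    have h1 := mul_le_mul_of_nonneg_left
      (Finset.sum_le_sum fun x (_ : x ∈ Finset.univ) => sq_mul_log_sq_le (hf x) hc) hn1.le
    have h2 : (n : ℝ)⁻¹ * ∑ x, (2 / 3 * f x ^ 3 / c + f x ^ 2 - 2 * c * f x + c ^ 2 / 3 +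
        f x ^ 2 * Real.log (c ^ 2)) = 2 / 3 * ((n : ℝ)⁻¹ * ∑ x, f x ^ 3) / c + 4 / 3 * c ^ 2 -
          2 * c * m + N * Real.log N := by
      simp only [Finset.sum_add_distrib, Finset.sum_sub_distrib, ← Finset.mul_sum,
        ← Finset.sum_mul, ← Finset.sum_div, hsumf, hsumf2, Finset.sum_const, Finset.card_univ,
        ZMod.card, nsmul_eq_mul, hc2]
      field_simp
      ring
    rw [h2, hcube] at h1
    linarith
  rw [henergy]
  exact hent.trans (entropy_bound_arith hc hm0 hs0 hsN (sum_cube_le hn h hmean))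

/-! ### Optimality -/

/-- Second-order expansion of log(1 + t) with error 2|t|³. Since (1 + t)² ≤ 9/4, that error
contributes 9|t|³, and the leftover t⁴ at most |t|³, whence 10. -/
theorem sq_mul_log_sq_ge {t : ℝ} (ht : |t| ≤ 1 / 2) :
    2 * t + 3 * t ^ 2 - 10 * |t| ^ 3 ≤ (1 + t) ^ 2 * Real.log ((1 + t) ^ 2) := by
  have hlt : |-t| < 1 := by rw [abs_neg]; linarith
  have h := Real.abs_log_sub_add_sum_range_le hlt 2
  simp only [Finset.sum_range_succ, Finset.sum_range_zero, abs_neg] at h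
  have h1 : |t| ^ (2 + 1) / (1 - |t|) ≤ 2 * |t| ^ 3 := by
    rw [div_le_iff₀ (by linarith)]
    have h4 := mul_nonneg (pow_nonneg (abs_nonneg t) 3) (by linarith : 0 ≤ 1 - 2 * |t|)
    norm_num
    nlinarith
  have h2 : t - t ^ 2 / 2 - 2 * |t| ^ 3 ≤ Real.log (1 + t) := by
    have := (abs_le.mp (h.trans h1)).1
    norm_num at this
    linarith
  have hb := abs_le.mp ht
  have h3 := mul_le_mul_of_nonneg_left h2 (sq_nonneg (1 + t))
  rw [Real.log_pow]
  have h4 : 0 ≤ |t| ^ 3 := pow_nonneg (abs_nonneg t) 3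
  have h5 : (1 + t) ^ 2 * |t| ^ 3 ≤ 9 / 4 * |t| ^ 3 :=
    mul_le_mul_of_nonneg_right (by nlinarith) h4
  have h6 : t ^ 4 ≤ |t| ^ 3 := by
    have : t ^ 4 = |t| ^ 3 * |t| := by rw [← pow_succ, Even.pow_abs (by decide)]
    rw [this]
    nlinarith
  push_cast
  nlinarith

theorem psi_one {n : ℕ} [NeZero n] (hn : 2 ≤ n) : psi n 1 = 1 := by
  have : Fact (1 < n) := ⟨hn⟩
  have : (2 : ℝ) ≤ n := by exact_mod_cast hn
  rw [psi, ZMod.val_one, Nat.cast_one, min_eq_left]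
  linarith

theorem psi_neg (n : ℕ) [NeZero n] (k : ZMod n) : psi n (-k) = psi n k := by
  by_cases hk : k = 0
  · rw [hk, neg_zero]
  have : NeZero k := ⟨hk⟩
  rw [psi, psi, ZMod.val_neg_of_ne_zero, Nat.cast_sub (ZMod.val_lt k).le, min_comm]
  congr 1
  ring

/-- For f = 1 + ε cos(2πx/n) the entropy is at least 2ε²v - O(ε³) and the energy is exactly ε²v,
where v is the mean square of the cosine. -/
theorem two_le_of_lsi {n : ℕ} [NeZero n] (hn : 2 ≤ n) {C : ℝ} (hC : LSI n (psi n) C) :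
    2 ≤ C := by
  have : Fact (1 < n) := ⟨hn⟩
  have hn0 : (n : ℝ) ≠ 0 := Nat.cast_ne_zero.mpr (NeZero.ne n)
  have hn1 : (0 : ℝ) < (n : ℝ)⁻¹ := by positivity
  set g : ZMod n → ℝ := fun x => (chi n 1 x).re with hg
  have hgabs : ∀ x, |g x| ≤ 1 := fun x =>
    (Complex.abs_re_le_norm _).trans (by rw [chi, AddChar.norm_apply])
  have hgsum : ∑ x, g x = 0 := by
    have h := AddChar.sum_mulShift (1 : ZMod n) (ZMod.isPrimitive_stdAddChar n)
    rw [if_neg one_ne_zero, Nat.cast_zero] at h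
    have h' : ∑ x, chi n 1 x = 0 := by
      rw [← h]
      exact Finset.sum_congr rfl fun x _ => by rw [chi, mul_comm]
    simp only [hg, ← Complex.re_sum, h', Complex.zero_re]
  set v := (n : ℝ)⁻¹ * ∑ x, g x ^ 2 with hv
  have hgsum2 : ∑ x, g x ^ 2 = n * v := by rw [hv]; field_simp
  have hvpos : 0 < v := by
    refine mul_pos hn1 (Finset.sum_pos' (fun _ _ => sq_nonneg _) ⟨0, Finset.mem_univ _, ?_⟩)
    simp [hg, chi]
  have hgchi : ∀ x, (g x : ℂ) = chi n 1 x / 2 + chi n (-1) x / 2 := by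
    intro x
    have : chi n (-1) x = (starRingEnd ℂ) (chi n 1 x) := by rw [conj_chi, chi, neg_mul]
    rw [this, hg, Complex.re_eq_add_conj]
    ring
  have henergy : ∀ ε : ℝ, (innerL2 n (fun x => ((1 + ε * g x : ℝ) : ℂ))
      (multiplier n (psi n) (fun x => ((1 + ε * g x : ℝ) : ℂ)))).re = ε ^ 2 * v := by
    intro ε
    -- A sum of indicators also covers n = 2, where 1 = -1 and the two halves add up.
    set a : ZMod n → ℂ := fun j => (if j = 0 then 1 else 0) + ((if j = 1 then (ε : ℂ) / 2 else 0) +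
      (if j = -1 then (ε : ℂ) / 2 else 0)) with ha
    have hexp : (fun x => ((1 + ε * g x : ℝ) : ℂ)) = fun x => ∑ j, a j * chi n j x := by
      funext x
      have h0 : chi n 0 x = 1 := by simp [chi]
      simp only [ha, add_mul, Finset.sum_add_distrib, ite_mul, zero_mul, Finset.sum_ite_eq',
        Finset.mem_univ, if_true, h0]
      push_cast
      rw [hgchi]
      ring
    have hmul : multiplier n (psi n) (fun x => ((1 + ε * g x : ℝ) : ℂ)) =
        fun x => ((ε * g x : ℝ) : ℂ) := by
      rw [hexp, multiplier_sum_chi]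
      funext x
      have h0 : psi n 0 = 0 := by simp [psi]
      simp only [ha, mul_add, add_mul, Finset.sum_add_distrib, mul_ite, ite_mul, zero_mul, mul_zero,
        Finset.sum_ite_eq', Finset.mem_univ, if_true, h0, psi_neg, psi_one hn]
      push_cast
      rw [hgchi]
      ring
    rw [hmul, innerL2, integral_mu]
    have : (n : ℂ)⁻¹ * ∑ x, ((1 + ε * g x : ℝ) : ℂ) * (starRingEnd ℂ) ((ε * g x : ℝ) : ℂ) =
        (((n : ℝ)⁻¹ * ∑ x, (1 + ε * g x) * (ε * g x) : ℝ) : ℂ) := by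
      push_cast
      simp
    rw [this, Complex.ofReal_re]
    have e : ∀ x, (1 + ε * g x) * (ε * g x) = ε * g x + ε ^ 2 * g x ^ 2 := fun x => by ring
    simp only [e, Finset.sum_add_distrib, ← Finset.mul_sum, hgsum, hgsum2]
    field_simp
    ring
  have hent : ∀ ε : ℝ, 0 < ε → ε ≤ 1 / 2 →
      2 * ε ^ 2 * v - 10 * ε ^ 3 - (ε ^ 2 * v) ^ 2 ≤ entropy n (fun x => 1 + ε * g x) := by
    intro ε hε hε2
    rw [entropy_eq_sum]
    have hN : (n : ℝ)⁻¹ * ∑ x, (1 + ε * g x) ^ 2 = 1 + ε ^ 2 * v := by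
      have e : ∀ x, (1 + ε * g x) ^ 2 = 1 + 2 * ε * g x + ε ^ 2 * g x ^ 2 := fun x => by ring
      simp only [e, Finset.sum_add_distrib, ← Finset.mul_sum, hgsum, hgsum2, Finset.sum_const,
        Finset.card_univ, ZMod.card, nsmul_eq_mul]
      field_simp
      ring
    have hpt : ∀ x, 2 * ε * g x + 3 * ε ^ 2 * g x ^ 2 - 10 * ε ^ 3 ≤
        (1 + ε * g x) ^ 2 * Real.log ((1 + ε * g x) ^ 2) := by
      intro x
      have h1 : |ε * g x| ≤ ε := by
        rw [abs_mul, abs_of_pos hε]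
        nlinarith [hgabs x]
      have h2 := sq_mul_log_sq_ge (h1.trans hε2)
      have h3 : |ε * g x| ^ 3 ≤ ε ^ 3 := pow_le_pow_left₀ (abs_nonneg _) h1 3
      nlinarith
    have hsum := mul_le_mul_of_nonneg_left
      (Finset.sum_le_sum fun x (_ : x ∈ Finset.univ) => hpt x) hn1.le
    have hl : (n : ℝ)⁻¹ * ∑ x, (2 * ε * g x + 3 * ε ^ 2 * g x ^ 2 - 10 * ε ^ 3) =
        3 * ε ^ 2 * v - 10 * ε ^ 3 := by
      simp only [Finset.sum_add_distrib, Finset.sum_sub_distrib, ← Finset.mul_sum, hgsum, hgsum2,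
        Finset.sum_const, Finset.card_univ, ZMod.card, nsmul_eq_mul]
      field_simp
      ring
    rw [hl] at hsum
    rw [hN]
    have hτ : 0 ≤ ε ^ 2 * v := by positivity
    have hlog := Real.log_le_sub_one_of_pos (by linarith : 0 < 1 + ε ^ 2 * v)
    nlinarith
  by_contra! hlt
  have hineq : ∀ ε : ℝ, 0 < ε → ε ≤ 1 / 2 → (2 - C) * v ≤ ε * (10 + v ^ 2) := by
    intro ε hε hε2
    have h1 := hC (fun x => 1 + ε * g x) fun x => by nlinarith [abs_le.mp (hgabs x)]
    rw [henergy] at h1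
    have h2 := (hent ε hε hε2).trans h1
    have h3 : ε ^ 2 * ((2 - C) * v) ≤ ε ^ 2 * (ε * (10 + v ^ 2)) := by
      have : ε ^ 4 * v ^ 2 ≤ ε ^ 3 * v ^ 2 :=
        mul_le_mul_of_nonneg_right (pow_le_pow_of_le_one hε.le (by linarith) (by norm_num))
          (sq_nonneg v)
      nlinarith
    exact le_of_mul_le_mul_left h3 (by positivity)
  have hpos : 0 < (2 - C) * v := mul_pos (by linarith) hvpos
  set δ := (2 - C) * v
  have hK : 0 < 10 + v ^ 2 := by positivity
  -- This ε makes the right-hand side at most δ / 2, contradicting δ > 0.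
  have h1 := hineq (min (1 / 2) (δ / (2 * (10 + v ^ 2)))) (by positivity) (min_le_left _ _)
  have h2 : min (1 / 2) (δ / (2 * (10 + v ^ 2))) * (10 + v ^ 2) ≤ δ / 2 := by
    refine (mul_le_mul_of_nonneg_right (min_le_right _ _) hK.le).trans (le_of_eq ?_)
    field_simp
  linarith

end CyclicLSI

theorem theorem1p2 (n k : ℕ) [NeZero n] (hk : 1 ≤ k) (hn : n = 3 * 2 ^ k ∨ n = 2 ^ k) :
    CyclicLSI.LSI n (CyclicLSI.psi n) 2 ∧
      ∀ C : ℝ, CyclicLSI.LSI n (CyclicLSI.psi n) C → 2 ≤ C := by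
  have h2 : Even (2 ^ k) := (Nat.even_pow' (by omega)).mpr even_two
  have heven : Even n := by
    rcases hn with rfl | rfl
    · exact h2.mul_left 3
    · exact h2
  have hle : 2 ≤ n := Nat.le_of_dvd (Nat.pos_of_ne_zero (NeZero.ne n)) heven.two_dvd
  exact ⟨CyclicLSI.lsi_two_of_even heven, fun C hC => CyclicLSI.two_le_of_lsi hle hC⟩
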